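/- Let $n_t\ge 2$, let $H\in\mathbb{R}^{n_r\times n_t}$ be a matrix of rank one with nonnegative entries, let $\sigma>0$, and let $\alpha=(\alpha_1,\dots,\alpha_{n_t})\in[0,1]^{n_t}$ with $\alpha_1\ge\alpha_2\ge\dots\ge\alpha_{n_t}$. The rank-one bounded-cost constrained optical intensity channel (BC-OIC) is the channel $\mathbf{Y}=H\mathbf{X}+\mathbf{Z}$, where $\mathbf{Z}\sim\mathcal{N}(0,\sigma^2 I_{n_r})$ is independent of $\mathbf{X}$. Its capacity is $$\mathsf{C}_{\mathrm{B}}(H,\alpha,\sigma)=\sup I(\mathbf{X};\mathbf{Y}),$$ where the supremum is over all laws of a random vector $\mathbf{X}=(X_1,\dots,X_{n_t})^{\mathsf T}$ such that, for every $k$, $0\le X_k\le 1$ almost surely and $\mathbb{E}[X_k]\le\alpha_k$. Let $H=UBV^{\mathsf T}$ be a singular value decomposition with $U$, $V$ orthogonal and the singular values of $H$ in descending order on the diagonal of $B$. Let $\sigma_1>0$ be the unique nonzero singular value, let $\mathbf{v}_1=(v_1^{(1)},\dots,v_1^{(n_t)})^{\mathsf T}$ be the first column of $V$, and let the sign be chosen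 such that $\mathbf{1}^{\mathsf T}\mathbf{v}_1=\sum_{i=1}^{n_t}v_1^{(i)}>0$. Then $$\mathsf{C}_{\mathrm{B}}(H,\alpha,\sigma)=\sup_{\mathscr{P}_S} I\left(S;\,S+\frac{\widetilde Z}{\sigma_1(\mathbf{1}^{\mathsf T}\mathbf{v}_1)}\right),$$ where $\widetilde Z\sim\mathcal{N}(0,\sigma^2)$ is independent of $S$, and the supremum is over all probability laws $\mathscr{P}_S$ of a real random variable $S$ with $\operatorname{supp} S\subseteq[0,1]$ and $$\mathbb{E}\left[\left(S-\sum_{i=1}^{k}\frac{v_1^{(i)}}{\mathbf{1}^{\mathsf T}\mathbf{v}_1}\right)_+\right]\le\frac{1}{\mathbf{1}^{\mathsf T}\mathbf{v}_1}\sum_{i=k+1}^{n_t}v_1^{(i)}\alpha_i,\qquad k\in\{0,1,\dots,n_t-1\},$$ with $(a)_+=\max\{a,0\}$. -/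

import Mathlib

open MeasureTheory ProbabilityTheory
open scoped ENNReal

noncomputable section

namespace OIC

/-- Joint law of the input `X ∼ μ` and the output `f X + Z` of an additive-noise channel, where the
noise `Z ∼ ν` is independent of `X`. -/
def channelJoint {E F : Type*} [MeasurableSpace E] [MeasurableSpace F] [Add F]
    (μ : Measure E) (f : E → F) (ν : Measure F) : Measure (E × F) :=
  (μ.prod ν).map (fun p => (p.1, f p.1 + p.2))

/-- Mutual information (in nats) of a pair with joint law `ρ`: the Kullback-Leibler divergence of
`ρ` from the product of its two marginals. -/
def mutualInfo {E F : Type*} [MeasurableSpace E] [MeasurableSpace F]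
    (ρ : Measure (E × F)) : ℝ≥0∞ :=
  InformationTheory.klDiv ρ (ρ.fst.prod ρ.snd)

/-- The law `μ` of the input vector satisfies the bounded-cost constraints: almost surely `0 ≤ X_k`
and `X_k ≤ 1`, and `E[X_k] ≤ α_k`, for every transmit antenna `k`. -/
structure BoundedCost {nt : ℕ} (α : Fin nt → ℝ) (μ : Measure (EuclideanSpace ℝ (Fin nt))) :
    Prop where
  isProbabilityMeasure : IsProbabilityMeasure μ
  nonneg : ∀ k, ∀ᵐ x ∂μ, 0 ≤ x k
  peak : ∀ k, ∀ᵐ x ∂μ, x k ≤ 1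
  mean_le : ∀ k, ∫ x, x k ∂μ ≤ α k

/-- Law of the noise vector `Z ∼ N(0, σ² I)`. -/
def noiseLaw (nr : ℕ) (σ : ℝ) : Measure (EuclideanSpace ℝ (Fin nr)) :=
  multivariateGaussian 0 (σ ^ 2 • (1 : Matrix (Fin nr) (Fin nr) ℝ))

/-- Capacity of the bounded-cost constrained channel `Y = H X + Z`: the supremum of `I(X; Y)` over
all admissible input laws. -/
def capacityB {nr nt : ℕ} (H : Matrix (Fin nr) (Fin nt) ℝ) (α : Fin nt → ℝ) (σ : ℝ) : ℝ≥0∞ :=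
  ⨆ (μ : Measure (EuclideanSpace ℝ (Fin nt))) (_ : BoundedCost α μ),
    mutualInfo (channelJoint μ (fun x => Matrix.toEuclideanLin H x) (noiseLaw nr σ))

/-- The singular values of `H` in descending order (indexed from `0`, and zero from the rank on). -/
def singularValue {nr nt : ℕ} (H : Matrix (Fin nr) (Fin nt) ℝ) (i : ℕ) : ℝ :=
  (Matrix.toEuclideanLin H).singularValues i

/-- `H = U B Vᵀ` is a singular value decomposition: `U`, `V` are orthogonal, and `B` carries the
singular values of `H` in descending order on its diagonal and is zero elsewhere. -/
structure IsSVD {nr nt : ℕ} (H : Matrix (Fin nr) (Fin nt) ℝ) (U : Matrix (Fin nr) (Fin nr) ℝ)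
    (V : Matrix (Fin nt) (Fin nt) ℝ) : Prop where
  left_orthogonal : U ∈ Matrix.orthogonalGroup (Fin nr) ℝ
  right_orthogonal : V ∈ Matrix.orthogonalGroup (Fin nt) ℝ
  eq_mul : H = U * Matrix.of (fun (i : Fin nr) (j : Fin nt) =>
    if (i : ℕ) = (j : ℕ) then singularValue H i else 0) * V.transpose

/-- The law `μ` of the scalar `S` satisfies `supp S ⊆ [0,1]` and, with `|v| = ∑ i, v i`,
`E[(S - ∑_{i ≤ k} v_i / |v|)₊] ≤ (1 / |v|) ∑_{i > k} v_i α_i` for `k = 0, …, nt - 1`.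
The entries are indexed from `0`, so the first `k` of them are those with index `< k`. -/
structure StopLoss {nt : ℕ} (v α : Fin nt → ℝ) (μ : Measure ℝ) : Prop where
  isProbabilityMeasure : IsProbabilityMeasure μ
  supp : ∀ᵐ s ∂μ, s ∈ Set.Icc (0 : ℝ) 1
  stopLoss_le : ∀ k : ℕ, k < nt →
    ∫ s, max (s - ∑ i : Fin nt with i.val < k, v i / (∑ j, v j)) 0 ∂μ
      ≤ (1 / (∑ j, v j)) * ∑ i : Fin nt with k ≤ i.val, v i * α i

/-- Law of `Z / c` for a scalar `Z ∼ N(0, σ²)`. -/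
def scaledNoiseLaw (σ c : ℝ) : Measure ℝ :=
  (gaussianReal 0 (σ ^ 2).toNNReal).map (fun z => z / c)

end OIC

end

/-! A rank-one `H` equals `σ₁ u v₁ᵀ` with `u` a unit vector, and nonnegativity of `H` together with
the sign choice gives `v₁ ≥ 0`. Hence the signal is `c S u`, where `c = σ₁ ∑ v₁` and `S` is the mean
of the inputs with weights `w i = v₁ i / ∑ v₁`. The noise is isotropic Gaussian, so the output
component along `u` is sufficient and `I(X; Y) = I(S; S + Z/c)`
(`mutualInfo_channelJoint_noiseLaw`).

It remains to see that the laws of `S` are exactly the stop-loss laws. Necessity is a pointwise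
bound (`stopLoss_map_weightedMean`). For sufficiency, `s` must be split into masses `m i ≤ w i` with
`E[m i] ≤ w i α i` (`exists_allocation`). Each order of filling the containers gives one splitting,
and a mixture over all orders is used. If no mixture met the bounds, a separating hyperplane would
give nonnegative prices at which every order is too expensive; but filling the cheapest containers
first stays within budget, by Abel summation and the stop-loss inequalities for arbitrary
subfamilies. -/

namespace OIC

/-! ### Splitting a scalar in [0,1] among containers -/

section Filling

variable {n : ℕ}

/-- Abel summation: a nonnegative nondecreasing `c` is a nonnegative combination of indicators of
tails. The induction peels off the constant `c 0`. -/
lemma sum_mul_nonpos_of_monotone (c d : Fin n → ℝ) (hc : Monotone c) (hc0 : ∀ i, 0 ≤ c i)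
    (hd : ∀ k < n, ∑ j : Fin n with k ≤ j.val, d j ≤ 0) : ∑ j, c j * d j ≤ 0 := by
  induction n with
  | zero => simp
  | succ n ih =>
    have h0 : ∑ j, d j ≤ 0 := by simpa using hd 0 (by omega)
    have h1 : ∑ j : Fin n, (c j.succ - c 0) * d j.succ ≤ 0 := by
      refine ih (fun j => c j.succ - c 0) (fun j => d j.succ) ?_ ?_ ?_
      · intro i j hij
        exact sub_le_sub_right (hc (by simpa using hij)) _
      · intro i
        exact sub_nonneg.2 (hc (Fin.zero_le _))
      · intro k hk
        have := hd (k + 1) (by omega)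
        rw [Finset.sum_filter, Fin.sum_univ_succ] at this
        rw [Finset.sum_filter]
        simpa using this
    have h2 : ∑ j, c j * d j = c 0 * ∑ j, d j + ∑ j : Fin n, (c j.succ - c 0) * d j.succ := by
      rw [Fin.sum_univ_succ, Fin.sum_univ_succ (f := d), mul_add, Finset.mul_sum, add_assoc,
        ← Finset.sum_add_distrib]
      congr 1
      refine Finset.sum_congr rfl fun j _ => ?_
      ring
    have h3 := mul_nonpos_of_nonneg_of_nonpos (hc0 0) h0
    linarith

/-- The sum of the first `k` entries of `w`. -/
def prefixSum (w : Fin n → ℝ) (k : ℕ) : ℝ := ∑ i : Fin n with i.val < k, w i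

lemma prefixSum_zero (w : Fin n → ℝ) : prefixSum w 0 = 0 := by simp [prefixSum]

lemma prefixSum_self (w : Fin n → ℝ) : prefixSum w n = ∑ i, w i := by simp [prefixSum]

lemma prefixSum_succ (w : Fin n → ℝ) (i : Fin n) :
    prefixSum w (i + 1) = prefixSum w i + w i := by
  have : (Finset.univ.filter fun j : Fin n => j.val < i + 1) =
      insert i (Finset.univ.filter fun j : Fin n => j.val < i) := by
    ext j
    simp only [Finset.mem_filter, Finset.mem_univ, true_and, Finset.mem_insert, Fin.ext_iff]
    omega
  rw [prefixSum, this, Finset.sum_insert (by simp), prefixSum, add_comm]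

/-- The mass that the `i`-th of consecutive containers of sizes `w` receives when they are filled
one after the other with total mass `s`. -/
def fillAmount (w : Fin n → ℝ) (i : Fin n) (s : ℝ) : ℝ :=
  max (s - prefixSum w i) 0 - max (s - prefixSum w (i + 1)) 0

@[fun_prop]
lemma continuous_fillAmount (w : Fin n → ℝ) (i : Fin n) : Continuous (fillAmount w i) := by
  unfold fillAmount
  fun_prop

lemma fillAmount_nonneg {w : Fin n → ℝ} {i : Fin n} (hw : 0 ≤ w i) (s : ℝ) :
    0 ≤ fillAmount w i s := by
  rw [fillAmount, prefixSum_succ]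
  exact sub_nonneg.2 (max_le_max (by linarith) le_rfl)

lemma fillAmount_le {w : Fin n → ℝ} {i : Fin n} (hw : 0 ≤ w i) (s : ℝ) :
    fillAmount w i s ≤ w i := by
  rw [fillAmount, prefixSum_succ, sub_le_iff_le_add]
  refine max_le ?_ ?_
  · linarith [le_max_left (s - (prefixSum w i + w i)) 0]
  · linarith [le_max_right (s - (prefixSum w i + w i)) 0]

lemma sum_tail_sub_succ (f : ℕ → ℝ) {k : ℕ} (hk : k ≤ n) :
    ∑ j : Fin n with k ≤ j.val, (f j - f (j + 1)) = f k - f n := by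
  rw [Finset.sum_filter,
    Fin.sum_univ_eq_sum_range (fun j => if k ≤ j then f j - f (j + 1) else 0) n]
  induction n, hk using Nat.le_induction with
  | base =>
    rw [sub_self]
    exact Finset.sum_eq_zero fun j hj => if_neg (by simpa using hj)
  | succ m hm ih =>
    rw [Finset.sum_range_succ, ih, if_pos hm]
    ring

lemma sum_tail_fillAmount (w : Fin n → ℝ) {k : ℕ} (hk : k ≤ n) (s : ℝ) :
    ∑ j : Fin n with k ≤ j.val, fillAmount w j s =
      max (s - prefixSum w k) 0 - max (s - ∑ i, w i) 0 := by
  rw [← prefixSum_self]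
  exact sum_tail_sub_succ (fun j => max (s - prefixSum w j) 0) hk

lemma exists_le_le_succ (f : ℕ → ℝ) (t : ℝ) (hn : 0 < n) (h0 : f 0 ≤ t) (h1 : t ≤ f n) :
    ∃ k < n, f k ≤ t ∧ t ≤ f (k + 1) := by
  induction n with
  | zero => omega
  | succ m ih =>
    by_cases h : f m ≤ t
    · exact ⟨m, by omega, h, h1⟩
    · have hm : 0 < m := Nat.pos_of_ne_zero fun hm => h (hm ▸ h0)
      obtain ⟨k, hk, h⟩ := ih hm (le_of_not_ge h)
      exact ⟨k, by omega, h⟩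

lemma integrable_of_ae_mem_Icc {μ : Measure ℝ} [IsFiniteMeasure μ]
    (hμ : ∀ᵐ s ∂μ, s ∈ Set.Icc (0 : ℝ) 1) {f : ℝ → ℝ} (hf : Continuous f) : Integrable f μ := by
  obtain ⟨C, hC⟩ := (isCompact_Icc (a := (0 : ℝ)) (b := 1)).exists_bound_of_continuousOn
    hf.continuousOn
  exact Integrable.of_bound hf.aestronglyMeasurable C (hμ.mono fun s hs => hC s hs)

variable {μ : Measure ℝ} [IsProbabilityMeasure μ] {w α : Fin n → ℝ}

/-- The stop-loss inequalities at the partial sums of `w` imply one for every subfamily of `w`. -/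
lemma integral_max_sub_le_of_prefix (hμ : ∀ᵐ s ∂μ, s ∈ Set.Icc (0 : ℝ) 1)
    (hw : ∀ i, 0 ≤ w i) (hw1 : ∑ i, w i = 1) (hα : Antitone α)
    (h : ∀ k < n, ∫ s, max (s - prefixSum w k) 0 ∂μ ≤ ∑ i : Fin n with k ≤ i.val, w i * α i)
    (p : Fin n → Prop) [DecidablePred p] :
    ∫ s, max (s - ∑ i with p i, w i) 0 ∂μ ≤ ∑ i with ¬ p i, w i * α i := by
  set t := ∑ i with p i, w i with ht
  have hn : 0 < n := by
    rcases Nat.eq_zero_or_pos n with rfl | hn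
    · simp at hw1
    · exact hn
  -- The case `k = n`, where both sides vanish, is needed because the upper end of the bracket
  -- around `t` may be `prefixSum w n`.
  have hend : ∀ k ≤ n, ∫ s, max (s - prefixSum w k) 0 ∂μ
      ≤ ∑ i : Fin n with k ≤ i.val, w i * α i := by
    intro k hk
    rcases hk.lt_or_eq with hk | rfl
    · exact h k hk
    · have h1 : ∫ s, max (s - prefixSum w k) 0 ∂μ = 0 := by
        rw [prefixSum_self, hw1]
        refine integral_eq_zero_of_ae (hμ.mono fun s hs => ?_)
        exact max_eq_right (by linarith [hs.2])
      rw [h1, Finset.sum_eq_zero]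
      intro i hi
      have := i.2
      simp at hi
      omega
  obtain ⟨k, hk, hk1, hk2⟩ := exists_le_le_succ (prefixSum w) t hn
    (by rw [prefixSum_zero]; exact Finset.sum_nonneg fun i _ => hw i)
    (by rw [prefixSum_self]; exact Finset.sum_le_univ_sum_of_nonneg hw)
  have hs := prefixSum_succ w ⟨k, hk⟩
  simp only at hs
  set P := prefixSum w k with hP
  set Q := prefixSum w (k + 1) with hQ
  set a := w ⟨k, hk⟩ with ha
  -- `t = (1 - θ) P + θ Q`; convexity of the stop-loss function in its threshold then interpolates
  -- between two prefixes.
  obtain ⟨θ, hθ0, hθ1, hθ⟩ : ∃ θ : ℝ, 0 ≤ θ ∧ θ ≤ 1 ∧ θ * a = t - P := by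
    have ha0 : 0 ≤ a := hw _
    rcases ha0.eq_or_lt with h0 | h0
    · exact ⟨0, le_rfl, zero_le_one, by linarith⟩
    · exact ⟨(t - P) / a, div_nonneg (by linarith) ha0, (div_le_one h0).2 (by linarith),
        div_mul_cancel₀ _ h0.ne'⟩
  have hconv : ∀ s, max (s - t) 0 ≤ (1 - θ) * max (s - P) 0 + θ * max (s - Q) 0 := by
    intro s
    have h1 := mul_le_mul_of_nonneg_left (le_max_left (s - P) 0) (sub_nonneg.2 hθ1)
    have h2 := mul_le_mul_of_nonneg_left (le_max_left (s - Q) 0) hθ0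
    refine max_le ?_ ?_
    · rw [hs] at h2 ⊢
      linarith
    · exact add_nonneg (mul_nonneg (sub_nonneg.2 hθ1) (le_max_right _ _))
        (mul_nonneg hθ0 (le_max_right _ _))
  have hint : ∀ c : ℝ, Integrable (fun s => max (s - c) 0) μ := fun c =>
    integrable_of_ae_mem_Icc hμ (by fun_prop)
  have hI : ∫ s, max (s - t) 0 ∂μ ≤
      (1 - θ) * ∑ i : Fin n with k ≤ i.val, w i * α i
        + θ * ∑ i : Fin n with k + 1 ≤ i.val, w i * α i := by
    calc ∫ s, max (s - t) 0 ∂μ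
        ≤ ∫ s, ((1 - θ) * max (s - P) 0 + θ * max (s - Q) 0) ∂μ :=
          integral_mono (hint t) (((hint P).const_mul _).add ((hint Q).const_mul _)) hconv
      _ = (1 - θ) * ∫ s, max (s - P) 0 ∂μ + θ * ∫ s, max (s - Q) 0 ∂μ := by
          rw [integral_add ((hint P).const_mul _) ((hint Q).const_mul _),
            integral_const_mul, integral_const_mul]
      _ ≤ _ := add_le_add
          (mul_le_mul_of_nonneg_left (hend k hk.le) (sub_nonneg.2 hθ1))
          (mul_le_mul_of_nonneg_left (hend (k + 1) hk) hθ0)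
  have htail : ∑ i : Fin n with k ≤ i.val, w i * α i
      = a * α ⟨k, hk⟩ + ∑ i : Fin n with k + 1 ≤ i.val, w i * α i := by
    have : (Finset.univ.filter fun j : Fin n => k ≤ j.val) =
        insert ⟨k, hk⟩ (Finset.univ.filter fun j : Fin n => k + 1 ≤ j.val) := by
      ext j
      simp only [Finset.mem_filter, Finset.mem_univ, true_and, Finset.mem_insert, Fin.ext_iff]
      omega
    rw [this, Finset.sum_insert (by simp)]
  -- Exchange argument with pivot `α k`: as `α` decreases, indices that only the prefix contains
  -- have `α i ≥ α k`, and those that only `p` contains have `α i ≤ α k`.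
  have hexch : 0 ≤ ∑ i : Fin n, ((if i.val < k then 1 else 0) - (if p i then 1 else 0)) *
      (w i * (α i - α ⟨k, hk⟩)) := by
    refine Finset.sum_nonneg fun i _ => ?_
    by_cases hik : i.val < k
    · have h1 : α ⟨k, hk⟩ ≤ α i := hα (Fin.le_def.2 hik.le)
      have h2 := mul_nonneg (hw i) (sub_nonneg.2 h1)
      by_cases hpi : p i <;> simp [hik, hpi, h2]
    · have h1 : α i ≤ α ⟨k, hk⟩ := hα (Fin.le_def.2 (not_lt.1 hik))
      have h2 := mul_nonpos_of_nonneg_of_nonpos (hw i) (sub_nonpos.2 h1)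
      by_cases hpi : p i <;> simp [hik, hpi, h2]
  have e1 : ∑ i : Fin n, ((if i.val < k then 1 else 0) - (if p i then 1 else 0)) *
      (w i * (α i - α ⟨k, hk⟩)) =
      (∑ i : Fin n with i.val < k, w i * α i - ∑ i with p i, w i * α i)
        - α ⟨k, hk⟩ * (P - t) := by
    rw [hP, ht, prefixSum]
    simp only [Finset.sum_filter, ← Finset.sum_sub_distrib, Finset.mul_sum]
    refine Finset.sum_congr rfl fun i _ => ?_
    split_ifs <;> ring
  have e2 : ∑ i : Fin n with i.val < k, w i * α i + ∑ i : Fin n with k ≤ i.val, w i * α i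
      = ∑ i, w i * α i := by
    simpa only [not_lt] using
      Finset.sum_filter_add_sum_filter_not Finset.univ (fun i : Fin n => i.val < k)
        (fun i => w i * α i)
  have e3 := Finset.sum_filter_add_sum_filter_not Finset.univ p (fun i => w i * α i)
  rw [e1] at hexch
  have e4 : θ * (a * α ⟨k, hk⟩) = (t - P) * α ⟨k, hk⟩ := by rw [← mul_assoc, hθ]
  rw [htail] at hI e2
  nlinarith

/-- Containers of sizes `w`, filled in the order `τ 0, τ 1, …`: the mass that container `i`
receives. -/
def permFill (w : Fin n → ℝ) (τ : Equiv.Perm (Fin n)) (i : Fin n) (s : ℝ) : ℝ :=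
  fillAmount (w ∘ τ) (τ.symm i) s

@[fun_prop]
lemma continuous_permFill (w : Fin n → ℝ) (τ : Equiv.Perm (Fin n)) (i : Fin n) :
    Continuous (permFill w τ i) :=
  continuous_fillAmount _ _

lemma permFill_nonneg (hw : ∀ i, 0 ≤ w i) (τ : Equiv.Perm (Fin n)) (i : Fin n) (s : ℝ) :
    0 ≤ permFill w τ i s :=
  fillAmount_nonneg (w := w ∘ τ) (hw _) s

lemma permFill_le (hw : ∀ i, 0 ≤ w i) (τ : Equiv.Perm (Fin n)) (i : Fin n) (s : ℝ) :
    permFill w τ i s ≤ w i := by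
  simpa [permFill] using fillAmount_le (w := w ∘ τ) (i := τ.symm i) (hw _) s

lemma sum_permFill (hw1 : ∑ i, w i = 1) (τ : Equiv.Perm (Fin n)) {s : ℝ}
    (hs : s ∈ Set.Icc (0 : ℝ) 1) : ∑ i, permFill w τ i s = s := by
  have h := sum_tail_fillAmount (w ∘ τ) (Nat.zero_le n) s
  rw [prefixSum_zero, show ∑ i, (w ∘ τ) i = 1 by rw [← hw1]; exact Equiv.sum_comp τ w,
    max_eq_right (a := s - 1) (by linarith [hs.2]), sub_zero, sub_zero, max_eq_left hs.1] at h
  rw [← Equiv.sum_comp τ]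
  simpa [permFill] using h

/-- With `c` as price per unit mass, fill the cheapest containers first. By Abel summation only the
tails of this order matter, and each is controlled by the stop-loss inequality of a subfamily. -/
lemma exists_perm_sum_mul_le (hμ : ∀ᵐ s ∂μ, s ∈ Set.Icc (0 : ℝ) 1)
    (hw : ∀ i, 0 ≤ w i) (hw1 : ∑ i, w i = 1) (hα : Antitone α)
    (h : ∀ k < n, ∫ s, max (s - prefixSum w k) 0 ∂μ ≤ ∑ i : Fin n with k ≤ i.val, w i * α i)
    (c : Fin n → ℝ) (hc : ∀ i, 0 ≤ c i) :
    ∃ τ : Equiv.Perm (Fin n),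
      ∑ i, c i * ∫ s, permFill w τ i s ∂μ ≤ ∑ i, c i * (w i * α i) := by
  refine ⟨Tuple.sort c, ?_⟩
  set τ := Tuple.sort c
  rw [← sub_nonpos, ← Finset.sum_sub_distrib, ← Equiv.sum_comp τ]
  simp_rw [← mul_sub]
  refine sum_mul_nonpos_of_monotone (fun j => c (τ j)) _ (Tuple.monotone_sort c) (fun _ => hc _) ?_
  intro k hk
  have hint : ∀ c : ℝ, Integrable (fun s => max (s - c) 0) μ := fun c =>
    integrable_of_ae_mem_Icc hμ (by fun_prop)
  rw [Finset.sum_sub_distrib, ← integral_finsetSum _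
    fun i _ => integrable_of_ae_mem_Icc hμ (by fun_prop), sub_nonpos]
  have hsub := integral_max_sub_le_of_prefix hμ hw hw1 hα h (fun i => (τ.symm i).val < k)
  have e1 : ∑ i with (τ.symm i).val < k, w i = prefixSum (w ∘ τ) k := by
    rw [prefixSum, Finset.sum_filter, Finset.sum_filter, ← Equiv.sum_comp τ]
    simp
  have e2 : ∑ i with ¬ (τ.symm i).val < k, w i * α i
      = ∑ j : Fin n with k ≤ j.val, w (τ j) * α (τ j) := by
    rw [Finset.sum_filter, Finset.sum_filter, ← Equiv.sum_comp τ]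
    simp
  rw [e1, e2] at hsub
  refine le_trans (integral_mono_ae ?_ (hint _) (Filter.Eventually.of_forall fun s => ?_)) hsub
  · exact integrable_of_ae_mem_Icc hμ (by fun_prop)
  · simp only [permFill, Equiv.symm_apply_apply]
    rw [sum_tail_fillAmount _ hk.le]
    -- The overflow term is dropped; only its sign is used.
    exact sub_le_self _ (le_max_right _ _)

/-- The expected fills of the mixtures form a compact convex set. If it missed the closed orthant
below `w i * α i`, a separating functional would contradict `exists_perm_sum_mul_le`. -/
lemma exists_mixture_integral_permFill_le (hμ : ∀ᵐ s ∂μ, s ∈ Set.Icc (0 : ℝ) 1)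
    (hw : ∀ i, 0 ≤ w i) (hw1 : ∑ i, w i = 1) (hα : Antitone α)
    (h : ∀ k < n, ∫ s, max (s - prefixSum w k) 0 ∂μ ≤ ∑ i : Fin n with k ≤ i.val, w i * α i) :
    ∃ q ∈ stdSimplex ℝ (Equiv.Perm (Fin n)),
      ∀ i, ∑ τ, q τ * ∫ s, permFill w τ i s ∂μ ≤ w i * α i := by
  set y : Equiv.Perm (Fin n) → Fin n → ℝ := fun τ i => ∫ s, permFill w τ i s ∂μ with hy
  let Φ : (Equiv.Perm (Fin n) → ℝ) →ₗ[ℝ] (Fin n → ℝ) := Fintype.linearCombination ℝ y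
  have hΦ : ∀ q i, Φ q i = ∑ τ, q τ * y τ i := by
    intro q i
    simp [Φ, Fintype.linearCombination_apply]
  by_contra hcon
  have hdisj : Disjoint (Φ '' stdSimplex ℝ (Equiv.Perm (Fin n)))
      (Set.Iic fun i => w i * α i) := by
    rw [Set.disjoint_left]
    rintro _ ⟨q, hq, rfl⟩ hle
    exact hcon ⟨q, hq, fun i => by simpa [hΦ] using hle i⟩
  obtain ⟨f, u, v, hu, huv, hv⟩ := geometric_hahn_banach_compact_closed
    ((convex_stdSimplex ℝ _).linear_image Φ)
    ((isCompact_stdSimplex ℝ _).image Φ.continuous_of_finiteDimensional)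
    (convex_Iic _) isClosed_Iic hdisj
  have hf : ∀ x : Fin n → ℝ, f x = ∑ i, x i * f (Pi.single i 1) := by
    intro x
    conv_lhs => rw [pi_eq_sum_univ' x, map_sum]
    refine Finset.sum_congr rfl fun i _ => ?_
    rw [map_smul, smul_eq_mul]
  -- The orthant is unbounded below, so a positive coefficient would make `f` unbounded below on it.
  -- Thus `-f` is a price vector.
  have hneg : ∀ i, f (Pi.single i 1) ≤ 0 := by
    intro i
    by_contra! hpos
    obtain ⟨r, hr⟩ := exists_nat_gt ((f (fun i => w i * α i) - v) / f (Pi.single i 1))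
    have := hv ((fun i => w i * α i) - (r : ℝ) • Pi.single i 1)
      (Set.mem_Iic.2 (sub_le_self _ (smul_nonneg r.cast_nonneg
        (Pi.single_nonneg.2 zero_le_one))))
    rw [map_sub, map_smul, smul_eq_mul] at this
    rw [div_lt_iff₀ hpos] at hr
    linarith
  obtain ⟨τ, hτ⟩ := exists_perm_sum_mul_le hμ hw hw1 hα h (fun i => - f (Pi.single i 1))
    (fun i => neg_nonneg.2 (hneg i))
  have h1 := hu (Φ (Pi.single τ 1)) ⟨_, single_mem_stdSimplex ℝ τ, rfl⟩
  have h2 := hv (fun i => w i * α i) Set.self_mem_Iic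
  have h3 : Φ (Pi.single τ 1) = y τ := by
    simp [Φ]
  rw [h3, hf] at h1
  rw [hf] at h2
  simp only [neg_mul, Finset.sum_neg_distrib, neg_le_neg_iff] at hτ
  have h4 : ∑ i, y τ i * f (Pi.single i 1) = ∑ i, f (Pi.single i 1) * ∫ s, permFill w τ i s ∂μ :=
    Finset.sum_congr rfl fun i _ => mul_comm _ _
  have h5 : ∑ i, w i * α i * f (Pi.single i 1) = ∑ i, f (Pi.single i 1) * (w i * α i) :=
    Finset.sum_congr rfl fun i _ => mul_comm _ _
  linarith

/-- A law on `[0,1]` that satisfies the stop-loss inequalities is the law of a weighted mean of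
variables in `[0,1]` with prescribed bounds on their expectations. -/
theorem exists_allocation (hμ : ∀ᵐ s ∂μ, s ∈ Set.Icc (0 : ℝ) 1)
    (hw : ∀ i, 0 ≤ w i) (hw1 : ∑ i, w i = 1) (hα : Antitone α) (hα0 : ∀ i, 0 ≤ α i)
    (h : ∀ k < n, ∫ s, max (s - prefixSum w k) 0 ∂μ ≤ ∑ i : Fin n with k ≤ i.val, w i * α i) :
    ∃ x : Fin n → ℝ → ℝ, (∀ i, Measurable (x i)) ∧ (∀ i s, 0 ≤ x i s) ∧ (∀ i s, x i s ≤ 1) ∧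
      (∀ s ∈ Set.Icc (0 : ℝ) 1, ∑ i, w i * x i s = s) ∧ ∀ i, ∫ s, x i s ∂μ ≤ α i := by
  obtain ⟨q, hq, hqle⟩ := exists_mixture_integral_permFill_le hμ hw hw1 hα h
  have hm0 : ∀ i s, 0 ≤ ∑ τ, q τ * permFill w τ i s := fun i s =>
    Finset.sum_nonneg fun τ _ => mul_nonneg (hq.1 τ) (permFill_nonneg hw τ i s)
  have hm1 : ∀ i s, ∑ τ, q τ * permFill w τ i s ≤ w i := fun i s =>
    calc ∑ τ, q τ * permFill w τ i s ≤ ∑ τ, q τ * w i :=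
          Finset.sum_le_sum fun τ _ => mul_le_mul_of_nonneg_left (permFill_le hw τ i s) (hq.1 τ)
      _ = w i := by rw [← Finset.sum_mul, hq.2, one_mul]
  -- If `w i = 0`, the quotient is `0` by convention and the mass is `0` too; the mean bound then
  -- uses `0 ≤ α i`.
  refine ⟨fun i s => (∑ τ, q τ * permFill w τ i s) / w i, fun i => ?_,
    fun i s => div_nonneg (hm0 i s) (hw i), fun i s => div_le_one_of_le₀ (hm1 i s) (hw i),
    fun s hs => ?_, fun i => ?_⟩
  · exact Continuous.measurable (by fun_prop)
  · have : ∀ i, w i * ((∑ τ, q τ * permFill w τ i s) / w i) = ∑ τ, q τ * permFill w τ i s := by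
      intro i
      rcases eq_or_ne (w i) 0 with h0 | h0
      · rw [h0, zero_mul]
        exact le_antisymm (hm0 i s) (h0 ▸ hm1 i s)
      · exact mul_div_cancel₀ _ h0
    simp_rw [this]
    rw [Finset.sum_comm]
    simp_rw [← Finset.mul_sum, sum_permFill hw1 _ hs]
    rw [← Finset.sum_mul, hq.2, one_mul]
  · rw [integral_div, integral_finsetSum _ fun τ _ =>
      (integrable_of_ae_mem_Icc hμ (by fun_prop))]
    simp_rw [integral_const_mul]
    rcases (hw i).eq_or_lt with h0 | h0
    · rw [← h0, div_zero]
      exact hα0 i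
    · rw [div_le_iff₀ h0, mul_comm (α i)]
      exact hqle i

end Filling

/-! ### Divergence under a sufficient statistic -/

section SufficientStatistic

variable {Ω Ω' : Type*} [MeasurableSpace Ω] [MeasurableSpace Ω']

lemma map_withDensity_comp (π : Measure Ω) {T : Ω → Ω'} (hT : Measurable T) {g : Ω' → ℝ≥0∞}
    (hg : Measurable g) : (π.withDensity (g ∘ T)).map T = (π.map T).withDensity g := by
  ext s hs
  rw [Measure.map_apply hT hs, withDensity_apply _ (hT hs), withDensity_apply _ hs,
    setLIntegral_map hs hg hT]
  rfl

/-- The Kullback-Leibler divergence is preserved by a statistic through which the density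
factors. -/
lemma klDiv_map_of_withDensity_comp {ρ π : Measure Ω} [IsFiniteMeasure ρ] [IsFiniteMeasure π]
    {T : Ω → Ω'} (hT : Measurable T) {g : Ω' → ℝ≥0∞} (hg : Measurable g)
    (hρ : ρ = π.withDensity (g ∘ T)) :
    InformationTheory.klDiv ρ π = InformationTheory.klDiv (ρ.map T) (π.map T) := by
  have hmap : ρ.map T = (π.map T).withDensity g := by rw [hρ, map_withDensity_comp π hT hg]
  have hac : ρ ≪ π := hρ ▸ withDensity_absolutelyContinuous _ _
  have hac' : ρ.map T ≪ π.map T := hmap ▸ withDensity_absolutelyContinuous _ _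
  have h1 : ρ.rnDeriv π =ᵐ[π] g ∘ T := by
    conv_lhs => rw [hρ]
    exact Measure.rnDeriv_withDensity π (hg.comp hT)
  have h2 : (ρ.map T).rnDeriv (π.map T) =ᵐ[π.map T] g := by
    rw [hmap]
    exact Measure.rnDeriv_withDensity _ hg
  rw [InformationTheory.klDiv_eq_lintegral_klFun_of_ac hac,
    InformationTheory.klDiv_eq_lintegral_klFun_of_ac hac',
    lintegral_congr_ae (h1.mono fun x hx => by rw [hx]),
    lintegral_congr_ae (h2.mono fun x hx => by rw [hx]), lintegral_map (by fun_prop) hT]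
  rfl

/-- The density of `ρ` relative to `π` is `e / q`, which again factors through `T`; the conditions
on `q` allow the cancellation. -/
lemma klDiv_map_of_withDensity {κ ρ π : Measure Ω} [IsFiniteMeasure ρ] [IsFiniteMeasure π]
    {T : Ω → Ω'} (hT : Measurable T) {e q : Ω' → ℝ≥0∞} (he : Measurable e) (hq : Measurable q)
    (hρ : ρ = κ.withDensity (e ∘ T)) (hπ : π = κ.withDensity (q ∘ T))
    (hq0 : ∀ᵐ x ∂κ, q (T x) ≠ 0) (hqtop : ∀ᵐ x ∂κ, q (T x) ≠ ∞) :
    InformationTheory.klDiv ρ π = InformationTheory.klDiv (ρ.map T) (π.map T) := by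
  refine klDiv_map_of_withDensity_comp hT (he.div hq) ?_
  rw [hπ, ← withDensity_mul _ (hq.comp hT) ((he.div hq).comp hT), hρ]
  refine withDensity_congr_ae ?_
  filter_upwards [hq0, hqtop] with x h0 ht
  exact (ENNReal.mul_div_cancel h0 ht).symm

end SufficientStatistic

/-! ### Mutual information from a shift density -/

section ShiftDensity

variable {E F : Type*} [MeasurableSpace E] [MeasurableSpace F]

/-- In an additive-noise channel whose noise law shifted by `f x` has a density that depends only on
`t x` and on the statistic `ℓ` of the output, the mutual information is that of `t X` and `ℓ Y`. -/
lemma mutualInfo_channelJoint_of_shift_density [Add F] [MeasurableAdd₂ F]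
    {μ : Measure E} [IsProbabilityMeasure μ] {ν : Measure F} [IsProbabilityMeasure ν]
    {f : E → F} (hf : Measurable f) {t : E → ℝ} (ht : Measurable t) {ℓ : F → ℝ}
    (hℓ : Measurable ℓ) {e : ℝ → ℝ → ℝ≥0∞} (he : Measurable (Function.uncurry e))
    (he0 : ∀ a b, e a b ≠ 0)
    (hshift : ∀ x, ∀ G : F → ℝ≥0∞, Measurable G →
      ∫⁻ z, G (f x + z) ∂ν = ∫⁻ z, e (t x) (ℓ z) * G z ∂ν) :
    mutualInfo (channelJoint μ f ν) =
      mutualInfo ((channelJoint μ f ν).map (Prod.map t ℓ)) := by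
  set ρ := channelJoint μ f ν with hρdef
  have hmeas : Measurable fun p : E × F => (p.1, f p.1 + p.2) := by fun_prop
  have : IsProbabilityMeasure ρ := Measure.isProbabilityMeasure_map hmeas.aemeasurable
  have hT : Measurable (Prod.map t ℓ) := ht.prodMap hℓ
  have hρ : ρ = (μ.prod ν).withDensity (Function.uncurry e ∘ Prod.map t ℓ) := by
    refine Measure.ext_of_lintegral _ fun φ hφ => ?_
    rw [hρdef, channelJoint, lintegral_map hφ hmeas,
      lintegral_withDensity_eq_lintegral_mul _ (he.comp hT) hφ,
      lintegral_prod _ (by fun_prop), lintegral_prod _ (by fun_prop)]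
    refine lintegral_congr fun x => ?_
    exact hshift x (fun z => φ (x, z)) (by fun_prop)
  have hfst : ρ.fst = μ := by
    rw [hρdef, channelJoint, Measure.fst, Measure.map_map measurable_fst hmeas]
    exact Measure.fst_prod
  set q : ℝ → ℝ≥0∞ := fun b => ∫⁻ x, e (t x) b ∂μ with hqdef
  have hq : Measurable q := by
    refine Measurable.lintegral_prod_left' (f := fun p : E × ℝ => e (t p.1) p.2) ?_
    exact he.comp (by fun_prop : Measurable fun p : E × ℝ => (t p.1, p.2))
  have hsnd : ρ.snd = ν.withDensity (q ∘ ℓ) := by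
    refine Measure.ext_of_lintegral _ fun φ hφ => ?_
    rw [Measure.snd, lintegral_map hφ measurable_snd, hρ,
      lintegral_withDensity_eq_lintegral_mul _ (he.comp hT) (by fun_prop),
      lintegral_withDensity_eq_lintegral_mul _ (hq.comp hℓ) hφ,
      lintegral_prod_symm _ (by fun_prop)]
    refine lintegral_congr fun z => ?_
    have : Measurable fun x => e (t x) (ℓ z) :=
      he.comp (by fun_prop : Measurable fun x => (t x, ℓ z))
    exact lintegral_mul_const (φ z) this
  have hπ : ρ.fst.prod ρ.snd =
      (μ.prod ν).withDensity ((fun p : ℝ × ℝ => q p.2) ∘ Prod.map t ℓ) := by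
    rw [hfst, hsnd, prod_withDensity_right (hq.comp hℓ)]
    rfl
  have hq0 : ∀ b, q b ≠ 0 := by
    intro b h
    have hm : Measurable fun x => e (t x) b := he.comp (by fun_prop : Measurable fun x => (t x, b))
    rw [hqdef] at h
    have := (lintegral_eq_zero_iff hm).1 h
    have hfalse : ∀ᵐ _ ∂μ, False := this.mono fun x hx => he0 _ _ hx
    exact hfalse.exists.elim fun _ h => h
  -- `q ∘ ℓ` is the density of the output law, so it has integral `1`.
  have hqtop : ∀ᵐ p ∂(μ.prod ν), q (ℓ p.2) ≠ ∞ := by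
    have h1 : ∫⁻ z, q (ℓ z) ∂ν ≠ ∞ := by
      have : IsProbabilityMeasure ρ.snd := inferInstance
      have h2 : ρ.snd Set.univ = 1 := measure_univ
      rw [hsnd, withDensity_apply _ MeasurableSet.univ, Measure.restrict_univ] at h2
      exact ne_of_eq_of_ne h2 ENNReal.one_ne_top
    have h2 := ae_lt_top (hq.comp hℓ) h1
    exact (Measure.quasiMeasurePreserving_snd.ae h2).mono fun p hp => hp.ne
  rw [mutualInfo, klDiv_map_of_withDensity hT he (hq.comp measurable_snd) hρ hπ
    (Filter.Eventually.of_forall fun p => hq0 _) hqtop, mutualInfo]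
  congr 1
  rw [← Measure.map_prod_map _ _ ht hℓ, Measure.fst, Measure.snd, Measure.fst, Measure.snd,
    Measure.map_map ht measurable_fst, Measure.map_map hℓ measurable_snd,
    Measure.map_map measurable_fst hT, Measure.map_map measurable_snd hT]
  rfl

end ShiftDensity

/-! ### Gaussian noise along one direction -/

section Gaussian

open scoped RealInnerProductSpace

lemma lintegral_gaussianReal_const_add {v : NNReal} (hv : v ≠ 0) (a : ℝ) {G : ℝ → ℝ≥0∞}
    (hG : Measurable G) :
    ∫⁻ z, G (a + z) ∂(gaussianReal 0 v) =
      ∫⁻ z, (gaussianPDF a v z / gaussianPDF 0 v z) * G z ∂(gaussianReal 0 v) := by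
  rw [← lintegral_map hG (measurable_const_add a), gaussianReal_map_const_add, zero_add,
    gaussianReal_of_var_ne_zero _ hv, gaussianReal_of_var_ne_zero _ hv,
    lintegral_withDensity_eq_lintegral_mul _ (by fun_prop) hG,
    lintegral_withDensity_eq_lintegral_mul _ (by fun_prop) (by fun_prop)]
  refine lintegral_congr fun z => ?_
  simp only [Pi.mul_apply]
  rw [← mul_assoc, ENNReal.mul_div_cancel (gaussianPDF_pos _ hv z).ne' gaussianPDF_ne_top]

variable {nr : ℕ}

instance (σ : ℝ) : IsProbabilityMeasure (noiseLaw nr σ) := by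
  unfold noiseLaw
  infer_instance

lemma charFun_noiseLaw (σ : ℝ) (x : EuclideanSpace ℝ (Fin nr)) :
    charFun (noiseLaw nr σ) x = Complex.exp (-((σ ^ 2 * ‖x‖ ^ 2 / 2 : ℝ) : ℂ)) := by
  have hS : (σ ^ 2 • (1 : Matrix (Fin nr) (Fin nr) ℝ)).PosSemidef :=
    Matrix.PosSemidef.one.smul (sq_nonneg σ)
  rw [noiseLaw, charFun_multivariateGaussian hS]
  congr 1
  have : x.ofLp ⬝ᵥ (σ ^ 2 • (1 : Matrix (Fin nr) (Fin nr) ℝ)).mulVec x.ofLp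
      = σ ^ 2 * ‖x‖ ^ 2 := by
    rw [Matrix.smul_mulVec, Matrix.one_mulVec, dotProduct_smul, EuclideanSpace.real_norm_sq_eq,
      smul_eq_mul, dotProduct]
    congr 1
    exact Finset.sum_congr rfl fun i _ => (sq _).symm
  rw [this]
  simp

/-- The component of isotropic Gaussian noise along a unit vector may be replaced by an independent
copy. -/
lemma map_replace_component_noiseLaw (σ : ℝ) {u : EuclideanSpace ℝ (Fin nr)} (hu : ‖u‖ = 1) :
    ((gaussianReal 0 (σ ^ 2).toNNReal).prod (noiseLaw nr σ)).map
      (fun p => p.1 • u + (p.2 - ⟪u, p.2⟫ • u)) = noiseLaw nr σ := by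
  have hm : Measurable fun p : ℝ × EuclideanSpace ℝ (Fin nr) =>
      p.1 • u + (p.2 - ⟪u, p.2⟫ • u) := by fun_prop
  have := Measure.isProbabilityMeasure_map
    (μ := (gaussianReal 0 (σ ^ 2).toNNReal).prod (noiseLaw nr σ)) hm.aemeasurable
  refine Measure.ext_of_charFun ?_
  ext x
  have huu : ⟪u, u⟫ = 1 := by rw [real_inner_self_eq_norm_sq, hu, one_pow]
  have hin : ∀ p : ℝ × EuclideanSpace ℝ (Fin nr), ⟪p.1 • u + (p.2 - ⟪u, p.2⟫ • u), x⟫ =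
      p.1 * ⟪u, x⟫ + ⟪p.2, x - ⟪u, x⟫ • u⟫ := by
    intro p
    simp only [inner_add_left, inner_sub_left, inner_sub_right, real_inner_smul_left,
      real_inner_smul_right, real_inner_comm u p.2]
    ring
  -- Pythagoras: the exponents of the two independent parts add up to that of the full noise.
  have hnorm : ‖x - ⟪u, x⟫ • u‖ ^ 2 = ‖x‖ ^ 2 - ⟪u, x⟫ ^ 2 := by
    rw [← real_inner_self_eq_norm_sq, ← real_inner_self_eq_norm_sq]
    simp only [inner_sub_left, inner_sub_right, real_inner_smul_left, real_inner_smul_right, huu,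
      real_inner_comm u x]
    ring
  rw [charFun_apply, integral_map hm.aemeasurable (by fun_prop)]
  simp_rw [hin]
  have hsplit : ∀ p : ℝ × EuclideanSpace ℝ (Fin nr),
      Complex.exp (((p.1 * ⟪u, x⟫ + ⟪p.2, x - ⟪u, x⟫ • u⟫ : ℝ) : ℂ) * Complex.I) =
      Complex.exp ((⟪u, x⟫ : ℂ) * p.1 * Complex.I) *
        Complex.exp ((⟪p.2, x - ⟪u, x⟫ • u⟫ : ℂ) * Complex.I) := by
    intro p
    rw [← Complex.exp_add]
    congr 1
    push_cast
    ring
  simp_rw [hsplit]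
  rw [integral_prod_mul (f := fun g : ℝ => Complex.exp ((⟪u, x⟫ : ℂ) * g * Complex.I))
    (g := fun z : EuclideanSpace ℝ (Fin nr) =>
      Complex.exp ((⟪z, x - ⟪u, x⟫ • u⟫ : ℂ) * Complex.I)), ← charFun_apply_real,
    ← charFun_apply, charFun_gaussianReal, charFun_noiseLaw, charFun_noiseLaw, hnorm,
    ← Complex.exp_add, Real.coe_toNNReal _ (sq_nonneg σ)]
  congr 1
  push_cast
  ring

/-- After the component along `u` is replaced by an independent copy, the shift acts on that scalar
alone, and the one-dimensional density ratio applies with the rest held fixed. -/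
lemma lintegral_noiseLaw_smul_add {σ : ℝ} (hσ : σ ≠ 0) {u : EuclideanSpace ℝ (Fin nr)}
    (hu : ‖u‖ = 1) (a : ℝ) {G : EuclideanSpace ℝ (Fin nr) → ℝ≥0∞} (hG : Measurable G) :
    ∫⁻ z, G (a • u + z) ∂(noiseLaw nr σ) =
      ∫⁻ z, (gaussianPDF a (σ ^ 2).toNNReal ⟪u, z⟫ / gaussianPDF 0 (σ ^ 2).toNNReal ⟪u, z⟫) * G z
        ∂(noiseLaw nr σ) := by
  have hv : (σ ^ 2).toNNReal ≠ 0 := by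
    rw [Ne, Real.toNNReal_eq_zero, not_le]
    positivity
  have hm : Measurable fun p : ℝ × EuclideanSpace ℝ (Fin nr) =>
      p.1 • u + (p.2 - ⟪u, p.2⟫ • u) := by fun_prop
  have hin : ∀ (g : ℝ) (z : EuclideanSpace ℝ (Fin nr)),
      ⟪u, g • u + (z - ⟪u, z⟫ • u)⟫ = g := by
    intro g z
    simp [inner_add_right, inner_sub_right, real_inner_smul_right, hu]
  conv_lhs => rw [← map_replace_component_noiseLaw σ hu]
  conv_rhs => rw [← map_replace_component_noiseLaw σ hu]
  rw [lintegral_map (by fun_prop) hm, lintegral_map (by fun_prop) hm,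
    lintegral_prod_symm _ (by fun_prop), lintegral_prod_symm _ (by fun_prop)]
  refine lintegral_congr fun z => ?_
  simp only [hin]
  rw [← lintegral_gaussianReal_const_add hv a
    (G := fun g => G (g • u + (z - ⟪u, z⟫ • u))) (by fun_prop)]
  refine lintegral_congr fun g => ?_
  rw [add_smul, add_assoc]

lemma map_inner_noiseLaw (σ : ℝ) {u : EuclideanSpace ℝ (Fin nr)} (hu : ‖u‖ = 1) :
    (noiseLaw nr σ).map (fun z => ⟪u, z⟫) = gaussianReal 0 (σ ^ 2).toNNReal := by
  conv_lhs => rw [← map_replace_component_noiseLaw σ hu]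
  rw [Measure.map_map (by fun_prop) (by fun_prop)]
  have : (fun z => ⟪u, z⟫) ∘ (fun p : ℝ × EuclideanSpace ℝ (Fin nr) =>
      p.1 • u + (p.2 - ⟪u, p.2⟫ • u)) = Prod.fst := by
    ext p
    simp [inner_add_right, inner_sub_right, real_inner_smul_right, hu]
  rw [this]
  exact Measure.fst_prod

/-- Reduction of a channel with a one-dimensional signal space to a scalar channel. -/
lemma mutualInfo_channelJoint_noiseLaw {E : Type*} [MeasurableSpace E] {μ : Measure E}
    [IsProbabilityMeasure μ] {σ c : ℝ} (hσ : σ ≠ 0) (hc : c ≠ 0)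
    {u : EuclideanSpace ℝ (Fin nr)} (hu : ‖u‖ = 1) {s : E → ℝ} (hs : Measurable s) :
    mutualInfo (channelJoint μ (fun x => (c * s x) • u) (noiseLaw nr σ)) =
      mutualInfo (channelJoint (μ.map s) (fun a => a) (scaledNoiseLaw σ c)) := by
  have hv : (σ ^ 2).toNNReal ≠ 0 := by
    rw [Ne, Real.toNNReal_eq_zero, not_le]
    positivity
  rw [mutualInfo_channelJoint_of_shift_density (f := fun x => (c * s x) • u) (by fun_prop) hs
    -- Dividing by `c` turns the component `c S + Z` into `S + Z / c`.
    (ℓ := fun y => ⟪u, y⟫ / c) (by fun_prop)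
    (e := fun a b => gaussianPDF (c * a) (σ ^ 2).toNNReal (c * b) /
      gaussianPDF 0 (σ ^ 2).toNNReal (c * b)) (by unfold Function.uncurry; fun_prop)
    (fun a b => (ENNReal.div_pos (gaussianPDF_pos _ hv _).ne' gaussianPDF_ne_top).ne')
    (fun x G hG => by
      simp_rw [mul_div_cancel₀ _ hc]
      exact lintegral_noiseLaw_smul_add hσ hu (c * s x) hG)]
  congr 1
  rw [channelJoint, channelJoint, scaledNoiseLaw, ← map_inner_noiseLaw σ hu,
    Measure.map_map (by fun_prop) (by fun_prop), Measure.map_map (by fun_prop) (by fun_prop),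
    Measure.map_prod_map _ _ hs (by fun_prop), Measure.map_map (by fun_prop) (by fun_prop)]
  congr 1
  ext p
  · rfl
  · simp [inner_add_right, real_inner_smul_right, hu, add_div, mul_div_cancel_left₀ _ hc]

end Gaussian

/-! ### Structure of a rank-one matrix -/

section RankOne

variable {nr nt : ℕ} {H : Matrix (Fin nr) (Fin nt) ℝ}

lemma finrank_range_toEuclideanLin (H : Matrix (Fin nr) (Fin nt) ℝ) :
    Module.finrank ℝ (LinearMap.range (Matrix.toEuclideanLin H)) = H.rank := by
  rw [Matrix.toEuclideanLin, Matrix.toLpLin_eq_toLin, ← Matrix.rank_eq_finrank_range_toLin]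

lemma singularValue_zero_pos (hrank : H.rank = 1) : 0 < singularValue H 0 := by
  rw [singularValue, LinearMap.singularValues_pos_iff_lt_finrank_range,
    finrank_range_toEuclideanLin, hrank]
  exact zero_lt_one

lemma singularValue_eq_zero (hrank : H.rank = 1) {i : ℕ} (hi : i ≠ 0) : singularValue H i = 0 := by
  rw [singularValue, LinearMap.singularValues_eq_zero_iff_le_finrank_range,
    finrank_range_toEuclideanLin, hrank]
  omega

lemma norm_column_eq_one {n : ℕ} {U : Matrix (Fin n) (Fin n) ℝ}
    (hU : U ∈ Matrix.orthogonalGroup (Fin n) ℝ) (j : Fin n) :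
    ‖WithLp.toLp 2 (fun i => U i j)‖ = 1 := by
  have h := congrFun₂ ((Matrix.mem_orthogonalGroup_iff' _ _).1 hU) j j
  rw [Matrix.mul_apply, Matrix.one_apply_eq] at h
  rw [← sq_eq_sq₀ (norm_nonneg _) zero_le_one, one_pow, EuclideanSpace.real_norm_sq_eq, ← h]
  refine Finset.sum_congr rfl fun i _ => ?_
  simp [sq]

/-- A singular value decomposition of a rank-one matrix reads `H = σ₁ u₁ v₁ᵀ`. -/
lemma IsSVD.exists_eq_mul_mul (hrank : H.rank = 1) {U : Matrix (Fin nr) (Fin nr) ℝ}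
    {V : Matrix (Fin nt) (Fin nt) ℝ} (hSVD : IsSVD H U V) (j₀ : Fin nt) (hj₀ : j₀.val = 0) :
    ∃ u : EuclideanSpace ℝ (Fin nr), ‖u‖ = 1 ∧ ∀ i j, H i j = singularValue H 0 * u i * V j j₀ := by
  have hnr : 0 < nr := by
    rcases Nat.eq_zero_or_pos nr with rfl | h
    · have := H.rank_le_height
      omega
    · exact h
  refine ⟨_, norm_column_eq_one hSVD.left_orthogonal ⟨0, hnr⟩, fun i j => ?_⟩
  conv_lhs => rw [hSVD.eq_mul]
  -- All singular values but the first vanish, so only column `j₀` of `U B` survives.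
  rw [Matrix.mul_apply, Finset.sum_eq_single j₀]
  · rw [Matrix.mul_apply, Finset.sum_eq_single ⟨0, hnr⟩]
    · simp [hj₀, mul_comm]
    · intro k _ hk
      have : k.val ≠ 0 := fun h => hk (Fin.ext h)
      simp [hj₀, this]
    · simp
  · intro k _ hk
    have hk0 : k.val ≠ 0 := fun h => hk (Fin.ext (h.trans hj₀.symm))
    have : (U * Matrix.of (fun (i : Fin nr) (j : Fin nt) =>
        if (i : ℕ) = (j : ℕ) then singularValue H i else 0)) i k = 0 := by
      rw [Matrix.mul_apply]
      refine Finset.sum_eq_zero fun l _ => ?_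
      rw [Matrix.of_apply]
      split_ifs with hl
      · rw [singularValue_eq_zero hrank (by omega), mul_zero]
      · rw [mul_zero]
    rw [this, zero_mul]
  · simp

/-- Summing a row with `u i ≠ 0` forces `u i > 0`, since `∑ v > 0`; that row then gives the sign of
each `v j`. -/
lemma nonneg_of_mul_mul_nonneg {v : Fin nt → ℝ} (hv : 0 < ∑ j, v j)
    {u : EuclideanSpace ℝ (Fin nr)} (hu : ‖u‖ = 1) {c : ℝ} (hc : 0 < c)
    (h : ∀ i j, 0 ≤ c * u i * v j) (j : Fin nt) : 0 ≤ v j := by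
  have hu0 : ∃ i, u i ≠ 0 := by
    by_contra! h0
    have : u = 0 := by
      ext i
      exact h0 i
    simp [this] at hu
  obtain ⟨i, hi⟩ := hu0
  have hsum : 0 ≤ (c * u i) * ∑ j, v j := by
    rw [Finset.mul_sum]
    exact Finset.sum_nonneg fun j _ => h i j
  have h1 : 0 ≤ c * u i := nonneg_of_mul_nonneg_left hsum hv
  have h2 : 0 < c * u i := h1.lt_of_ne (mul_ne_zero hc.ne' hi).symm
  exact nonneg_of_mul_nonneg_right (h i j) h2

end RankOne

/-! ### Input laws and laws of the weighted mean -/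

section InputLaws

variable {nt : ℕ} {v α : Fin nt → ℝ}

/-- The weighted mean of the entries of `x` with weights proportional to `v`. -/
noncomputable def weightedMean (v : Fin nt → ℝ) (x : EuclideanSpace ℝ (Fin nt)) : ℝ :=
  ∑ i, v i / (∑ j, v j) * x i

lemma measurable_weightedMean (v : Fin nt → ℝ) : Measurable (weightedMean v) := by
  unfold weightedMean
  fun_prop

lemma sum_div_sum_eq_one (hv : 0 < ∑ j, v j) : ∑ i, v i / (∑ j, v j) = 1 := by
  rw [← Finset.sum_div, div_self hv.ne']

/-- The peak constraint bounds the first `k` terms by their weights, so the excess is at most the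
sum of the remaining terms, whose means are bounded. -/
lemma stopLoss_map_weightedMean (hv : ∀ i, 0 ≤ v i) (hvs : 0 < ∑ j, v j)
    {μ : Measure (EuclideanSpace ℝ (Fin nt))} (hμ : BoundedCost α μ) :
    StopLoss v α (μ.map (weightedMean v)) := by
  have := hμ.isProbabilityMeasure
  have hm := measurable_weightedMean v
  have hw : ∀ i, 0 ≤ v i / (∑ j, v j) := fun i => div_nonneg (hv i) hvs.le
  have h0 : ∀ᵐ x ∂μ, ∀ k, 0 ≤ x k := ae_all_iff.2 hμ.nonneg
  have h1 : ∀ᵐ x ∂μ, ∀ k, x k ≤ 1 := ae_all_iff.2 hμ.peak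
  refine ⟨Measure.isProbabilityMeasure_map hm.aemeasurable, ?_, fun k hk => ?_⟩
  · rw [ae_map_iff (p := fun s => s ∈ Set.Icc (0 : ℝ) 1) hm.aemeasurable measurableSet_Icc]
    filter_upwards [h0, h1] with x hx0 hx1
    refine ⟨Finset.sum_nonneg fun i _ => mul_nonneg (hw i) (hx0 i), ?_⟩
    calc weightedMean v x ≤ ∑ i, v i / (∑ j, v j) :=
          Finset.sum_le_sum fun i _ => mul_le_of_le_one_right (hw i) (hx1 i)
      _ = 1 := sum_div_sum_eq_one hvs
  · have hint : ∀ i, Integrable (fun x : EuclideanSpace ℝ (Fin nt) => x i) μ := fun i => by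
      refine Integrable.of_bound (by fun_prop) 1 ?_
      filter_upwards [h0, h1] with x hx0 hx1
      rw [Real.norm_of_nonneg (hx0 i)]
      exact hx1 i
    rw [integral_map hm.aemeasurable (by fun_prop)]
    calc ∫ x, max (weightedMean v x - ∑ i : Fin nt with i.val < k, v i / (∑ j, v j)) 0 ∂μ
        ≤ ∫ x, ∑ i : Fin nt with k ≤ i.val, v i / (∑ j, v j) * x i ∂μ := by
          refine integral_mono_of_nonneg (Filter.Eventually.of_forall fun x => le_max_right _ _)
            (integrable_finsetSum _ fun i _ => (hint i).const_mul _) ?_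
          filter_upwards [h0, h1] with x hx0 hx1
          refine max_le ?_ (Finset.sum_nonneg fun i _ => mul_nonneg (hw i) (hx0 i))
          have hsplit := Finset.sum_filter_add_sum_filter_not Finset.univ
            (fun i : Fin nt => i.val < k) (fun i => v i / (∑ j, v j) * x i)
          simp only [not_lt] at hsplit
          have hle : ∑ i : Fin nt with i.val < k, v i / (∑ j, v j) * x i ≤
              ∑ i : Fin nt with i.val < k, v i / (∑ j, v j) :=
            Finset.sum_le_sum fun i _ => mul_le_of_le_one_right (hw i) (hx1 i)
          rw [weightedMean, ← hsplit]
          linarith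
      _ = ∑ i : Fin nt with k ≤ i.val, v i / (∑ j, v j) * ∫ x, x i ∂μ := by
          rw [integral_finsetSum _ fun i _ => (hint i).const_mul _]
          simp_rw [integral_const_mul]
      _ ≤ ∑ i : Fin nt with k ≤ i.val, v i / (∑ j, v j) * α i :=
          Finset.sum_le_sum fun i _ => mul_le_mul_of_nonneg_left (hμ.mean_le i) (hw i)
      _ = (1 / (∑ j, v j)) * ∑ i : Fin nt with k ≤ i.val, v i * α i := by
          rw [Finset.mul_sum]
          exact Finset.sum_congr rfl fun i _ => by ring

/-- The input is a deterministic function of `S`, namely the allocation of `exists_allocation`,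
whose weighted mean returns `s` on [0,1]. -/
lemma exists_boundedCost_map_weightedMean (hv : ∀ i, 0 ≤ v i) (hvs : 0 < ∑ j, v j)
    (hα : Antitone α) (hα0 : ∀ i, 0 ≤ α i) {ν : Measure ℝ} (hν : StopLoss v α ν) :
    ∃ μ, BoundedCost α μ ∧ μ.map (weightedMean v) = ν := by
  have := hν.isProbabilityMeasure
  obtain ⟨x, hxm, hx0, hx1, hxs, hxα⟩ := exists_allocation (w := fun i => v i / ∑ j, v j) hν.supp
    (fun i => div_nonneg (hv i) hvs.le) (sum_div_sum_eq_one hvs) hα hα0 (fun k hk => by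
      refine (hν.stopLoss_le k hk).trans_eq ?_
      rw [Finset.mul_sum]
      exact Finset.sum_congr rfl fun i _ => by ring)
  have hm : Measurable fun s => (WithLp.toLp 2 (fun i => x i s) : EuclideanSpace ℝ (Fin nt)) := by
    fun_prop
  refine ⟨ν.map fun s => WithLp.toLp 2 (fun i => x i s),
    ⟨Measure.isProbabilityMeasure_map hm.aemeasurable, fun k => ?_, fun k => ?_, fun k => ?_⟩, ?_⟩
  · rw [ae_map_iff hm.aemeasurable (measurableSet_le (by fun_prop) (by fun_prop))]
    exact Filter.Eventually.of_forall fun s => hx0 k s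
  · rw [ae_map_iff hm.aemeasurable (measurableSet_le (by fun_prop) (by fun_prop))]
    exact Filter.Eventually.of_forall fun s => hx1 k s
  · rw [integral_map hm.aemeasurable (by fun_prop)]
    exact hxα k
  · rw [Measure.map_map (measurable_weightedMean v) hm]
    conv_rhs => rw [← Measure.map_id (μ := ν)]
    exact Measure.map_congr (hν.supp.mono fun s hs => hxs s hs)

end InputLaws

end OIC

theorem corollary2 (nr nt : ℕ) (hnt : 2 ≤ nt)
    (H : Matrix (Fin nr) (Fin nt) ℝ) (hH : ∀ i j, 0 ≤ H i j) (hrank : H.rank = 1)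
    (α : Fin nt → ℝ) (hα : ∀ k, α k ∈ Set.Icc (0 : ℝ) 1) (hα_anti : Antitone α)
    (σ : ℝ) (hσ : 0 < σ)
    (U : Matrix (Fin nr) (Fin nr) ℝ) (V : Matrix (Fin nt) (Fin nt) ℝ) (hSVD : OIC.IsSVD H U V)
    (v₁ : Fin nt → ℝ) (hv₁ : ∀ i, v₁ i = V i ⟨0, by omega⟩) (hv₁_pos : 0 < ∑ i, v₁ i) :
    OIC.capacityB H α σ =
      ⨆ (μ : MeasureTheory.Measure ℝ) (_ : OIC.StopLoss v₁ α μ),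
        OIC.mutualInfo (OIC.channelJoint μ (fun s => s)
          (OIC.scaledNoiseLaw σ (OIC.singularValue H 0 * ∑ i, v₁ i))) := by
  obtain ⟨u, hu, hHu⟩ := hSVD.exists_eq_mul_mul hrank ⟨0, by omega⟩ rfl
  simp only [← hv₁] at hHu
  have hσ₁ := OIC.singularValue_zero_pos hrank
  have hv : ∀ i, 0 ≤ v₁ i :=
    OIC.nonneg_of_mul_mul_nonneg hv₁_pos hu hσ₁ fun i j => hHu i j ▸ hH i j
  have hsignal : (fun x => Matrix.toEuclideanLin H x) =
      fun x => ((OIC.singularValue H 0 * ∑ i, v₁ i) * OIC.weightedMean v₁ x) • u := by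
    funext x
    ext i
    rw [Matrix.ofLp_toLpLin, Matrix.toLin'_apply, Matrix.mulVec, dotProduct, PiLp.smul_apply,
      smul_eq_mul, OIC.weightedMean, Finset.mul_sum, Finset.sum_mul]
    refine Finset.sum_congr rfl fun j _ => ?_
    rw [hHu]
    field_simp
  have hmutual : ∀ μ, OIC.BoundedCost α μ →
      OIC.mutualInfo (OIC.channelJoint μ (fun x => Matrix.toEuclideanLin H x)
        (OIC.noiseLaw nr σ)) =
      OIC.mutualInfo (OIC.channelJoint (μ.map (OIC.weightedMean v₁)) (fun s => s)
          (OIC.scaledNoiseLaw σ (OIC.singularValue H 0 * ∑ i, v₁ i))) := by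
    intro μ hμ
    have := hμ.isProbabilityMeasure
    rw [hsignal]
    exact OIC.mutualInfo_channelJoint_noiseLaw hσ.ne' (mul_pos hσ₁ hv₁_pos).ne' hu
      (OIC.measurable_weightedMean v₁)
  refine le_antisymm (iSup₂_le fun μ hμ => ?_) (iSup₂_le fun ν hν => ?_)
  · rw [hmutual μ hμ]
    exact le_iSup₂_of_le _ (OIC.stopLoss_map_weightedMean hv hv₁_pos hμ) le_rfl
  · obtain ⟨μ, hμ, rfl⟩ :=
      OIC.exists_boundedCost_map_weightedMean hv hv₁_pos hα_anti (fun i => (hα i).1) hν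
    rw [← hmutual μ hμ]
    exact le_iSup₂_of_le μ hμ le_rfl
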